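/- Let $H$ be a complex Hilbert space with inner product $(\cdot,\cdot)$ and let $S$ be a closed, densely defined, symmetric linear operator in $H$ with a positive lower bound, i.e. there is $\mu>0$ with $(Sf,f)\ge\mu\|f\|^2$ for all $f\in\operatorname{dom}S$. Let $S_{\rm K}$ be the Krein--von Neumann extension of $S$, i.e. the restriction of the adjoint $S^*$ to $\operatorname{dom}S_{\rm K}=\operatorname{dom}S\dotplus\ker S^*$. Assume that the embedding into $H$ of the space $\operatorname{dom}S$, equipped with the norm $\|f\|_S=\|Sf\|$, is compact. Then the following hold. (i) The spectrum $\sigma(S_{\rm K})$ is contained in $[0,\infty)$, each of its points is an eigenvalue of $S_{\rm K}$ and an isolated point of $\sigma(S_{\rm K})$, and each positive eigenvalue of $S_{\rm K}$ has finite multiplicity. (ii) The positive eigenvalues of $S_{\rm K}$, counted with multiplicities, can be listed in nondecreasing order, $\lambda_1^+(S_{\rm K})\le\lambda_2^+(S_{\rm K})\le\dots$; the list is infinite if $\dim\operatorname{dom}S=\infty$, and it has exactly $\dim\operatorname{dom}S$ entries otherwise. (iii) For each $j\in\{1,2,\dots\}$ (with $j\le\dim\operatorname{dom}S$ if this dimension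 is finite), $$\lambda_j^+(S_{\rm K})=\min_{\substack{F\subset\operatorname{dom}S\\ \dim F=j}}\ \max_{\substack{f\in F\\ f\ne0}}\frac{\|Sf\|^2}{(Sf,f)},$$ where $F$ runs over the $j$-dimensional linear subspaces of $\operatorname{dom}S$, and the maximum for each such $F$ and the minimum over all of them are attained. -/

import Mathlib

open scoped LinearPMap InnerProductSpace

namespace KreinVN

variable {H : Type*} [NormedAddCommGroup H] [InnerProductSpace ℂ H]

/-- The eigenspace `ker (A - z)` of a partially defined operator `A` in `H`:
all `f ∈ dom A` with `A f = z f`. -/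
def eigenspace (A : H →ₗ.[ℂ] H) (z : ℂ) : Submodule ℂ H :=
  (LinearMap.ker (A.toFun - z • A.domain.subtype)).map A.domain.subtype

theorem mem_eigenspace {A : H →ₗ.[ℂ] H} {z : ℂ} {f : H} :
    f ∈ eigenspace A z ↔ ∃ hf : f ∈ A.domain, A ⟨f, hf⟩ = z • f := by
  simp [eigenspace, sub_eq_zero]

/-- `z` is an eigenvalue of `A`. -/
def IsEigenvalue (A : H →ₗ.[ℂ] H) (z : ℂ) : Prop :=
  ∃ f : A.domain, (f : H) ≠ 0 ∧ A f = z • (f : H)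

/-- The resolvent set: all `z` for which `A - z : dom A → H` has an everywhere defined
bounded two-sided inverse `R`. -/
def resolventSet (A : H →ₗ.[ℂ] H) : Set ℂ :=
  {z | ∃ R : H →L[ℂ] H,
    (∀ g : H, ∃ hg : R g ∈ A.domain, A ⟨R g, hg⟩ - z • R g = g) ∧
    (∀ f : A.domain, R (A f - z • (f : H)) = f)}

/-- The spectrum of a partially defined operator. -/
def spectrum (A : H →ₗ.[ℂ] H) : Set ℂ := (resolventSet A)ᶜ

/-- `lam 1 ≤ lam 2 ≤ …` (indices `1 ≤ j ≤ N`, with `N = ⊤` for an infinite list) is the list of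
all positive eigenvalues of `A`, in nondecreasing order and counted with multiplicities: every
positive number `t` occurs in it exactly `dim ker (A - t)` times. -/
structure IsPosEigenvalueList (A : H →ₗ.[ℂ] H) (N : ℕ∞) (lam : ℕ → ℝ) : Prop where
  pos : ∀ j : ℕ, 1 ≤ j → (j : ℕ∞) ≤ N → 0 < lam j
  mono : ∀ i j : ℕ, 1 ≤ i → i ≤ j → (j : ℕ∞) ≤ N → lam i ≤ lam j
  mult : ∀ t : ℝ, 0 < t →
    {j : ℕ | 1 ≤ j ∧ (j : ℕ∞) ≤ N ∧ lam j = t}.encard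
      = Cardinal.toENat (Module.rank ℂ (eigenspace A (t : ℂ)))

/-- The space `dom S`, to be equipped with the norm `‖f‖_S = ‖S f‖`. -/
def GraphSpace (S : H →ₗ.[ℂ] H) : Type _ := S.domain

instance (S : H →ₗ.[ℂ] H) : AddCommGroup (GraphSpace S) :=
  inferInstanceAs (AddCommGroup S.domain)

instance (S : H →ₗ.[ℂ] H) : Module ℂ (GraphSpace S) :=
  inferInstanceAs (Module ℂ S.domain)

/-- The operator `S`, as a linear map from `GraphSpace S` to `H`. -/
def GraphSpace.toFun (S : H →ₗ.[ℂ] H) : GraphSpace S →ₗ[ℂ] H := S.toFun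

/-- The embedding of `GraphSpace S` into `H`. -/
def GraphSpace.embedding (S : H →ₗ.[ℂ] H) : GraphSpace S →ₗ[ℂ] H := S.domain.subtype

/-- The (semi)norm `‖f‖_S = ‖S f‖`; it is a norm when `S` is injective. -/
noncomputable instance (S : H →ₗ.[ℂ] H) : SeminormedAddCommGroup (GraphSpace S) :=
  SeminormedAddCommGroup.induced (GraphSpace S) H (GraphSpace.toFun S)

theorem GraphSpace.norm_def (S : H →ₗ.[ℂ] H) (f : S.domain) :
    ‖(show GraphSpace S from f)‖ = ‖S f‖ := rfl

/-- The Rayleigh quotient `‖S f‖² / (S f, f)`; the denominator is real for symmetric `S`. -/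
noncomputable def rayleigh (S : H →ₗ.[ℂ] H) (f : S.domain) : ℝ :=
  ‖S f‖ ^ 2 / (⟪S f, (f : H)⟫_ℂ).re

variable [CompleteSpace H]

/-- The Krein--von Neumann extension `S_K`: the restriction of `S*` to `dom S + ker S*`. -/
noncomputable def kreinExtension (S : H →ₗ.[ℂ] H) : H →ₗ.[ℂ] H :=
  S†.domRestrict (S.domain ⊔ (LinearMap.ker S†.toFun).map S†.domain.subtype)

/-- For symmetric `S`, the domain is all of `dom S + ker S*`. -/
theorem kreinExtension_domain {S : H →ₗ.[ℂ] H} (hd : Dense (S.domain : Set H))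
    (hs : S.IsFormalAdjoint S) :
    (kreinExtension S).domain
      = S.domain ⊔ (LinearMap.ker S†.toFun).map S†.domain.subtype := by
  change (_ ⊓ S†.domain : Submodule ℂ H) = _
  refine inf_eq_left.2 (sup_le (LinearPMap.IsFormalAdjoint.le_adjoint hd hs).1 ?_)
  exact Submodule.map_subtype_le _ _

/-- If `S` has a positive lower bound, the sum `dom S + ker S*` is direct. -/
theorem disjoint_domain_ker_adjoint {S : H →ₗ.[ℂ] H} (hd : Dense (S.domain : Set H))
    (hpos : ∃ μ : ℝ, 0 < μ ∧ ∀ f : S.domain, μ * ‖(f : H)‖ ^ 2 ≤ (⟪S f, (f : H)⟫_ℂ).re) :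
    Disjoint S.domain ((LinearMap.ker S†.toFun).map S†.domain.subtype) := by
  rw [Submodule.disjoint_def]
  intro x hx hx'
  obtain ⟨y, hy, hyx⟩ := hx'
  obtain ⟨μ, h0, h⟩ := hpos
  have h1 := h ⟨x, hx⟩
  have h2 := LinearPMap.adjoint_isFormalAdjoint hd y ⟨x, hx⟩
  have h3 : S† y = 0 := hy
  have h4 : (y : H) = x := hyx
  rw [h3, inner_zero_left, h4] at h2
  have h5 : (⟪S ⟨x, hx⟩, x⟫_ℂ) = 0 := inner_eq_zero_symm.1 h2.symm
  rw [h5, Complex.zero_re] at h1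
  have h6 : ‖x‖ ^ 2 ≤ 0 := by nlinarith
  simpa using h6

end KreinVN

/-! Let `R` be the range of `S` and `P` the orthogonal projection onto `R`. The lower bound and the
closedness of `S` make `R` closed, and the compact embedding makes `Q = S⁻¹ : R → H` compact. Since
`ker S* = Rᗮ`, the relation `S_K u = v` means that `v = S f` for some `f ∈ dom S` with `P u = P f`
(`kreinExtension_apply_eq_iff`). So `S_K` is governed by the compression `T = P Q`, a compact
symmetric operator on `R`, positive because `(g, T g) = (S f, f)` for `g = S f`.

For `z ≠ 0`, the eigenspace of `S_K` at `z` is that of `T` at `z⁻¹`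
(`eigenspace_kreinExtension_eq_map`), and `z` is in the resolvent set of `S_K` if `z⁻¹` is in that
of `T` (`mem_resolventSet_kreinExtension`). The point `0` is an eigenvalue unless `R = H`, and then
`Q` inverts `S_K`. With a Hilbert basis of `R` such that `T b_i = k_i b_i`, the numbers `k_i > 0`
accumulate at most at `0`, and the positive eigenvalues of `S_K` are the `k_i⁻¹`.

The substitution `g = S f` turns the Rayleigh quotient into `‖g‖² / (g, T g)`, so the min-max
formula is the Courant–Fischer principle for `T`, inverted (`isLeast_isGreatest_rayleigh`). -/

open scoped LinearPMap InnerProductSpace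

universe u

/-! ### Nondecreasing numbering of a family of reals -/

/-- A family of reals with finite sublevel sets can be numbered `1, 2, …` in nondecreasing
order. -/
theorem exists_monotone_numbering {ι : Type*} (f : ι → ℝ) (hf : ∀ t, {i | f i ≤ t}.Finite) :
    ∃ r : ι → ℕ, Function.Injective r ∧
      (∀ j : ℕ, (1 ≤ j ∧ (j : ℕ∞) ≤ ENat.card ι) ↔ ∃ i, r i = j) ∧
      ∀ i k, r i ≤ r k → f i ≤ f k := by
  classical
  -- An arbitrary linear order on the indices breaks ties between equal values; the number of `k` is
  -- then the count of indices up to and including `k`, so numbering starts at `1`.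
  let _ : LinearOrder ι := linearOrderOfSTO WellOrderingRel
  let φ : ι → ℝ ×ₗ ι := fun i => toLex (f i, i)
  have hφ : Function.Injective φ := fun i k h => congrArg (fun p => (ofLex p).2) h
  have hφf : ∀ {i k}, φ i ≤ φ k → f i ≤ f k := by
    intro i k h
    rcases Prod.Lex.le_iff.1 h with h | h
    · exact h.le
    · exact h.1.le
  let s : ι → Set ι := fun k => {i | φ i ≤ φ k}
  have hs : ∀ k, (s k).Finite := fun k => (hf (f k)).subset fun i hi => hφf hi
  let r : ι → ℕ := fun k => (s k).ncard
  have hlt : ∀ {i k}, φ i < φ k → r i < r k := by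
    intro i k h
    refine Set.ncard_lt_ncard ⟨fun x hx => le_trans hx h.le, fun hsub => ?_⟩ (hs k)
    exact absurd (hsub (show k ∈ s k from le_refl (φ k))) (not_le.2 h)
  have hle : ∀ {i k}, r i ≤ r k → φ i ≤ φ k := fun h => by
    by_contra hc
    exact absurd h (not_le.2 (hlt (not_le.1 hc)))
  have hinj : Function.Injective r := fun i k h => hφ (le_antisymm (hle h.le) (hle h.ge))
  have hpos : ∀ k, 1 ≤ r k := fun k =>
    (Set.ncard_pos (hs k)).2 ⟨k, le_refl (φ k)⟩
  -- There are no gaps: the largest index strictly before `k` has number one less.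
  have hdesc : ∀ m, 1 ≤ m → (∃ k, r k = m + 1) → ∃ k, r k = m := by
    rintro m hm ⟨k, hk⟩
    have hk' : k ∈ s k := le_refl (φ k)
    have hc : (s k \ {k}).ncard = m := by
      have := Set.ncard_sdiff_singleton_of_mem hk'
      change (s k).ncard = m + 1 at hk
      omega
    have hfin : (s k \ {k}).Finite := (hs k).subset Set.sdiff_subset
    obtain ⟨a, ha, hmax⟩ := Set.exists_max_image (s k \ {k}) φ hfin
      ((Set.ncard_pos hfin).1 (by omega))
    refine ⟨a, ?_⟩
    have hlt' : φ a < φ k := lt_of_le_of_ne ha.1 fun h => ha.2 (hφ h)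
    have : s a = s k \ {k} := by
      ext i
      constructor
      · intro hi
        refine ⟨le_trans (show φ i ≤ φ a from hi) ha.1, fun h => ?_⟩
        rw [Set.mem_singleton_iff.1 h] at hi
        exact absurd hi (not_le.2 hlt')
      · exact hmax i
    change (s a).ncard = m
    rw [this, hc]
  have hdown : ∀ d m, 1 ≤ m → (∃ k, r k = m + d) → ∃ k, r k = m := by
    intro d
    induction d with
    | zero => exact fun m _ h => h
    | succ d ih => exact fun m hm h => ih m hm (hdesc (m + d) (by omega) h)
  refine ⟨r, hinj, fun j => ⟨?_, ?_⟩, fun i k h => hφf (hle h)⟩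
  · rintro ⟨hj, hjc⟩
    by_contra hcon
    -- A missed `j` bounds all numbers by `j - 1`, so there are at most `j - 1` indices.
    have hall : ∀ k, r k < j := by
      intro k
      by_contra hk
      obtain ⟨d, hd⟩ := Nat.exists_eq_add_of_le (not_lt.1 hk)
      exact hcon (hdown d j hj ⟨k, hd⟩)
    have h1 : (Set.range r).encard = ENat.card ι := by
      rw [← Set.image_univ, hinj.encard_image, Set.encard_univ]
    have h2 : Set.range r ⊆ ((Finset.Ico 1 j : Finset ℕ) : Set ℕ) := by
      rintro _ ⟨k, rfl⟩
      simpa using ⟨hpos k, hall k⟩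
    have h3 := Set.encard_le_encard h2
    rw [h1, Set.encard_coe_eq_coe_finsetCard, Nat.card_Ico] at h3
    have h4 : j ≤ j - 1 := by exact_mod_cast hjc.trans h3
    omega
  · rintro ⟨k, rfl⟩
    refine ⟨hpos k, ?_⟩
    change ((s k).ncard : ℕ∞) ≤ _
    rw [(hs k).cast_ncard_eq, ← Set.encard_univ]
    exact Set.encard_le_encard (Set.subset_univ _)

/-! ### Uniqueness of the list of positive eigenvalues -/

namespace KreinVN

section List

variable {H : Type*} [NormedAddCommGroup H] [InnerProductSpace ℂ H]

/-- Otherwise, by monotonicity, the second list could take the value `lam j` only at places before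
`j`. There it agrees with the first list, which takes that value once more at `j`. The two counts
are then different, yet both equal the dimension of the same eigenspace. -/
theorem IsPosEigenvalueList.le_of_forall_lt_eq {A : H →ₗ.[ℂ] H} {N N' : ℕ∞} {lam lam' : ℕ → ℝ}
    (h : IsPosEigenvalueList A N lam) (h' : IsPosEigenvalueList A N' lam') {j : ℕ}
    (hj : 1 ≤ j) (hjN : (j : ℕ∞) ≤ N) (heq : ∀ i < j, 1 ≤ i → lam i = lam' i) :
    (j : ℕ∞) ≤ N' ∧ lam' j ≤ lam j := by
  by_contra hcon
  have hpos := h.pos j hj hjN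
  have hsub : {k : ℕ | 1 ≤ k ∧ (k : ℕ∞) ≤ N' ∧ lam' k = lam j} ⊆
      {k : ℕ | 1 ≤ k ∧ k < j ∧ lam k = lam j} := by
    rintro k ⟨hk1, hkN, hk⟩
    have hkj : k < j := by
      by_contra hkj
      have hjk := not_lt.1 hkj
      have hjN' : (j : ℕ∞) ≤ N' := le_trans (by exact_mod_cast hjk) hkN
      exact hcon ⟨hjN', (h'.mono j k hj hjk hkN).trans_eq hk⟩
    exact ⟨hk1, hkj, (heq k hkj hk1).trans hk⟩
  have hss : {k : ℕ | 1 ≤ k ∧ k < j ∧ lam k = lam j} ⊂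
      {k : ℕ | 1 ≤ k ∧ (k : ℕ∞) ≤ N ∧ lam k = lam j} := by
    refine ⟨?_, fun hc => ?_⟩
    · rintro k ⟨hk1, hkj, hk⟩
      exact ⟨hk1, le_trans (by exact_mod_cast hkj.le) hjN, hk⟩
    · exact lt_irrefl j (hc ⟨hj, hjN, rfl⟩ : _ ∧ _).2.1
  have hfin : {k : ℕ | 1 ≤ k ∧ k < j ∧ lam k = lam j}.Finite :=
    (Set.finite_Iio j).subset fun k hk => hk.2.1
  have := (Set.encard_le_encard hsub).trans_lt (hfin.encard_lt_encard hss)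
  rw [h.mult _ hpos, h'.mult _ hpos] at this
  exact lt_irrefl _ this

theorem IsPosEigenvalueList.eq_of_le {A : H →ₗ.[ℂ] H} {N N' : ℕ∞} {lam lam' : ℕ → ℝ}
    (h : IsPosEigenvalueList A N lam) (h' : IsPosEigenvalueList A N' lam') (j : ℕ)
    (hj : 1 ≤ j) (hjN : (j : ℕ∞) ≤ N) : (j : ℕ∞) ≤ N' ∧ lam j = lam' j := by
  induction j using Nat.strong_induction_on with
  | _ j ih =>
    have heq : ∀ i < j, 1 ≤ i → lam i = lam' i := fun i hi h1 =>
      (ih i hi h1 (le_trans (by exact_mod_cast hi.le) hjN)).2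
    obtain ⟨h1, h2⟩ := h.le_of_forall_lt_eq h' hj hjN heq
    obtain ⟨-, h3⟩ := h'.le_of_forall_lt_eq h hj h1 fun i hi hi1 => (heq i hi hi1).symm
    exact ⟨h1, le_antisymm h3 h2⟩

end List

end KreinVN

/-! ### Compact symmetric operators diagonalized by a Hilbert basis -/

section Spectral

variable {E : Type u} [NormedAddCommGroup E] [InnerProductSpace ℂ E]

/-- The eigenspaces are closed, mutually orthogonal and have total span, so Hilbert bases of the
single eigenspaces, the possibly infinite-dimensional kernel included, unite to one of `E`. -/
theorem ContinuousLinearMap.exists_hilbertBasis_eigenvectors [CompleteSpace E] (T : E →L[ℂ] E)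
    (hT : IsCompactOperator T) (hsymm : (T : E →ₗ[ℂ] E).IsSymmetric) :
    ∃ (ι : Type u) (b : HilbertBasis ι ℂ E) (z : ι → ℂ), ∀ i, T (b i) = z i • b i := by
  obtain ⟨V, hmem, hV, horthV⟩ : ∃ V : ℂ → Submodule ℂ E, (∀ z x, x ∈ V z ↔ T x = z • x) ∧
      (⨆ z, V z)ᗮ = ⊥ ∧ OrthogonalFamily ℂ (fun z => V z) fun z => (V z).subtypeₗᵢ :=
    ⟨fun z => Module.End.eigenspace (T : E →ₗ[ℂ] E) z,
      fun z x => Module.End.mem_eigenspace_iff,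
      T.orthogonalComplement_iSup_eigenspaces_eq_bot hT hsymm,
      hsymm.orthogonalFamily_eigenspaces⟩
  have hcl : ∀ z, IsClosed (V z : Set E) := by
    intro z
    have : (V z : Set E) = {x | T x = z • x} := by ext x; exact hmem z x
    rw [this]
    exact isClosed_eq T.continuous (continuous_const_smul z)
  have : ∀ z, CompleteSpace (V z) := fun z => (hcl z).completeSpace_coe
  choose w c hc using fun z => exists_hilbertBasis ℂ (V z)
  have horth : Orthonormal ℂ fun a : Σ z, w z => (V a.1).subtypeₗᵢ (c a.1 a.2) :=
    horthV.orthonormal_sigma_orthonormal fun z => (c z).orthonormal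
  have hbot : (Submodule.span ℂ
      (Set.range fun a : Σ z, w z => (V a.1).subtypeₗᵢ (c a.1 a.2)))ᗮ = ⊥ := by
    rw [eq_bot_iff, ← hV]
    intro x hx
    rw [Submodule.mem_orthogonal'] at hx ⊢
    have hV : ∀ z, V z ≤ LinearMap.ker (innerSL ℂ x : E →ₗ[ℂ] ℂ) := by
      intro z y hy
      have h0 : (innerSL ℂ x).comp (V z).subtypeL = 0 := by
        refine ContinuousLinearMap.ext_on (s := Set.range (c z)) ?_ ?_
        · rw [dense_iff_closure_eq, ← Submodule.topologicalClosure_coe, (c z).dense_span]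
          rfl
        · rintro _ ⟨i, rfl⟩
          exact hx _ (Submodule.subset_span ⟨⟨z, i⟩, rfl⟩)
      exact congrArg (fun L => L ⟨y, hy⟩) h0
    intro u hu
    exact iSup_le hV hu
  refine ⟨Σ z, w z, HilbertBasis.mkOfOrthogonalEqBot horth hbot, fun a => a.1, fun a => ?_⟩
  rw [HilbertBasis.coe_mkOfOrthogonalEqBot]
  exact (hmem _ _).1 (c a.1 a.2).2

/-- A compact operator multiplies only finitely many members of an orthonormal family by factors
bounded away from zero. -/
theorem IsCompactOperator.finite_setOf_le_eigenvalue {T : E →L[ℂ] E}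
    (hT : IsCompactOperator T) {ι : Type*} {b : ι → E} (hb : Orthonormal ℂ b) {k : ι → ℝ}
    (hk : ∀ i, T (b i) = (k i : ℂ) • b i) {ε : ℝ} (hε : 0 < ε) : {i | ε ≤ k i}.Finite := by
  by_contra hinf
  have hinf' : {i | ε ≤ k i}.Infinite := hinf
  let u := hinf'.natEmbedding
  obtain ⟨K, hK, hsub⟩ := hT.image_closedBall_subset_compact (f := (T : E →ₗ[ℂ] E)) 1
  obtain ⟨a, -, φ, hφ, hlim⟩ := hK.tendsto_subseq (x := fun n => T (b (u n)))
    fun n => hsub ⟨b (u n), by simp [hb.1], rfl⟩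
  have hcau := hlim.cauchySeq
  obtain ⟨n, hn⟩ := Metric.cauchySeq_iff'.1 hcau ε hε
  have h1 : dist (T (b (u (φ (n + 1))))) (T (b (u (φ n)))) < ε := hn (n + 1) (Nat.le_succ n)
  have hne : (u (φ (n + 1)) : ι) ≠ u (φ n) := fun h =>
    absurd (hφ.injective (u.injective (Subtype.ext h))) (Nat.succ_ne_self n)
  have hk1 : ε ≤ k (u (φ (n + 1))) := (u (φ (n + 1))).2
  generalize (u (φ (n + 1)) : ι) = p at *
  generalize (u (φ n) : ι) = q at *
  rw [dist_eq_norm] at h1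
  -- The component along `b p` shows that images of distinct members stay at distance at least `ε`,
  -- so no subsequence of them is Cauchy.
  have h2 : ⟪b p, T (b p) - T (b q)⟫_ℂ = k p := by
    rw [hk, hk, inner_sub_right, inner_smul_right, inner_smul_right, hb.2 hne,
      inner_self_eq_norm_sq_to_K, hb.1]
    simp
  have h3 := norm_inner_le_norm (𝕜 := ℂ) (b p) (T (b p) - T (b q))
  rw [h2, hb.1, one_mul, Complex.norm_real, Real.norm_eq_abs] at h3
  linarith [le_abs_self (k p)]

theorem HilbertBasis.exists_real_eigenvalues [CompleteSpace E] (T : E →L[ℂ] E)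
    (hT : IsCompactOperator T) (hsymm : (T : E →ₗ[ℂ] E).IsSymmetric) :
    ∃ (ι : Type u) (b : HilbertBasis ι ℂ E) (k : ι → ℝ), ∀ i, T (b i) = (k i : ℂ) • b i := by
  obtain ⟨ι, b, z, h⟩ := T.exists_hilbertBasis_eigenvectors hT hsymm
  refine ⟨ι, b, fun i => (z i).re, fun i => ?_⟩
  have hev : Module.End.HasEigenvalue (T : E →ₗ[ℂ] E) (z i) :=
    Module.End.hasEigenvalue_of_hasEigenvector
      ⟨Module.End.mem_eigenspace_iff.2 (h i), b.orthonormal.ne_zero i⟩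
  rw [h, Complex.conj_eq_iff_re.1 (hsymm.conj_eigenvalue_eq_self hev)]

/-- A Hilbert basis and an algebraic one may differ in cardinality, but only when both are infinite,
and `toENat` sends all infinite cardinals to `⊤`. -/
theorem HilbertBasis.toENat_rank {ι : Type u} (b : HilbertBasis ι ℂ E) :
    Cardinal.toENat (Module.rank ℂ E) = ENat.card ι := by
  cases finite_or_infinite ι
  · have := Fintype.ofFinite ι
    rw [rank_eq_card_basis b.toOrthonormalBasis.toBasis]
    simp
  · rw [ENat.card_eq_top_of_infinite, Cardinal.toENat_eq_top]
    exact (Cardinal.aleph0_le_mk ι).trans b.orthonormal.linearIndependent.cardinal_le_rank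

section Diagonal

variable {T : E →L[ℂ] E} {ι : Type*} {b : HilbertBasis ι ℂ E} {k : ι → ℝ}

theorem HilbertBasis.inner_apply_of_diagonal (hsymm : (T : E →ₗ[ℂ] E).IsSymmetric)
    (hk : ∀ i, T (b i) = (k i : ℂ) • b i) (i : ι) (x : E) :
    ⟪b i, T x⟫_ℂ = k i * ⟪b i, x⟫_ℂ := by
  have h : ⟪T (b i), x⟫_ℂ = ⟪b i, T x⟫_ℂ := hsymm (b i) x
  rw [← h, hk, inner_smul_left, Complex.conj_ofReal]

theorem re_inner_mul_inner_symm (x y : E) : (⟪x, y⟫_ℂ * ⟪y, x⟫_ℂ).re = ‖⟪y, x⟫_ℂ‖ ^ 2 := by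
  have h : (⟪x, y⟫_ℂ * ⟪y, x⟫_ℂ).re = ‖⟪x, y⟫_ℂ * ⟪y, x⟫_ℂ‖ := inner_mul_symm_re_eq_norm (𝕜 := ℂ) x y
  rw [h, norm_mul, norm_inner_symm, sq]

theorem HilbertBasis.hasSum_norm_inner_sq (b : HilbertBasis ι ℂ E) (x : E) :
    HasSum (fun i => ‖⟪b i, x⟫_ℂ‖ ^ 2) (‖x‖ ^ 2) := by
  have h := Complex.hasSum_re (b.hasSum_inner_mul_inner x x)
  convert! h using 1
  · ext i
    exact (re_inner_mul_inner_symm x (b i)).symm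
  · rw [inner_self_eq_norm_sq_to_K]
    norm_cast

theorem HilbertBasis.hasSum_re_inner_of_diagonal (hsymm : (T : E →ₗ[ℂ] E).IsSymmetric)
    (hk : ∀ i, T (b i) = (k i : ℂ) • b i) (x : E) :
    HasSum (fun i => k i * ‖⟪b i, x⟫_ℂ‖ ^ 2) (⟪x, T x⟫_ℂ).re := by
  have h := Complex.hasSum_re (b.hasSum_inner_mul_inner x (T x))
  convert! h using 1
  ext i
  rw [HilbertBasis.inner_apply_of_diagonal hsymm hk, mul_left_comm, Complex.re_ofReal_mul]
  congr 1
  exact (re_inner_mul_inner_symm x (b i)).symm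

/-- Both sides are Parseval sums, compared term by term; a vanishing coefficient of `x` removes any
condition on `k i`. -/
theorem HilbertBasis.re_inner_le_of_diagonal (hsymm : (T : E →ₗ[ℂ] E).IsSymmetric)
    (hk : ∀ i, T (b i) = (k i : ℂ) • b i) {c : ℝ} {x : E}
    (h : ∀ i, ⟪b i, x⟫_ℂ = 0 ∨ k i ≤ c) : (⟪x, T x⟫_ℂ).re ≤ c * ‖x‖ ^ 2 := by
  refine hasSum_le (fun i => ?_) (HilbertBasis.hasSum_re_inner_of_diagonal hsymm hk x)
    ((b.hasSum_norm_inner_sq x).mul_left c)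
  rcases h i with h | h
  · simp [h]
  · gcongr

theorem HilbertBasis.le_re_inner_of_diagonal (hsymm : (T : E →ₗ[ℂ] E).IsSymmetric)
    (hk : ∀ i, T (b i) = (k i : ℂ) • b i) {c : ℝ} {x : E}
    (h : ∀ i, ⟪b i, x⟫_ℂ = 0 ∨ c ≤ k i) : c * ‖x‖ ^ 2 ≤ (⟪x, T x⟫_ℂ).re := by
  refine hasSum_le (fun i => ?_) ((b.hasSum_norm_inner_sq x).mul_left c)
    (HilbertBasis.hasSum_re_inner_of_diagonal hsymm hk x)
  rcases h i with h | h
  · simp [h]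
  · gcongr

theorem HilbertBasis.eq_zero_of_inner_eq_zero (b : HilbertBasis ι ℂ E) {x : E}
    (h : ∀ i, ⟪b i, x⟫_ℂ = 0) : x = 0 := by
  have h1 := b.hasSum_norm_inner_sq x
  simp only [h, norm_zero, ne_eq, OfNat.ofNat_ne_zero, not_false_eq_true, zero_pow] at h1
  simpa using h1.unique hasSum_zero

theorem HilbertBasis.eq_or_inner_eq_zero_of_diagonal (hsymm : (T : E →ₗ[ℂ] E).IsSymmetric)
    (hk : ∀ i, T (b i) = (k i : ℂ) • b i) {z : ℂ} {x : E} (hx : T x = z • x) (i : ι) :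
    z = k i ∨ ⟪b i, x⟫_ℂ = 0 := by
  have h := HilbertBasis.inner_apply_of_diagonal hsymm hk i x
  rw [hx, inner_smul_right] at h
  exact mul_eq_mul_right_iff.1 h

theorem HilbertBasis.mem_span_of_inner_eq_zero (b : HilbertBasis ι ℂ E) (J : Finset ι) {x : E}
    (h : ∀ i ∉ J, ⟪b i, x⟫_ℂ = 0) : x ∈ Submodule.span ℂ (b '' J) := by
  have h1 : x = ∑ i ∈ J, ⟪b i, x⟫_ℂ • b i := by
    rw [← sub_eq_zero]
    classical
    refine b.eq_zero_of_inner_eq_zero fun i => ?_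
    rw [inner_sub_right, inner_sum]
    simp only [inner_smul_right, orthonormal_iff_ite.1 b.orthonormal, mul_ite, mul_one, mul_zero,
      Finset.sum_ite_eq]
    split_ifs with hi
    · simp
    · simp [h i hi]
  rw [h1]
  exact Submodule.sum_mem _ fun i hi =>
    Submodule.smul_mem _ _ (Submodule.subset_span ⟨i, hi, rfl⟩)

/-- Finiteness lets the algebraic span serve in place of its closure. -/
theorem HilbertBasis.eigenspace_eq_span_of_diagonal (hsymm : (T : E →ₗ[ℂ] E).IsSymmetric)
    (hk : ∀ i, T (b i) = (k i : ℂ) • b i) {c : ℝ} (hc : {i | k i = c}.Finite) :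
    Module.End.eigenspace (T : E →ₗ[ℂ] E) (c : ℂ) = Submodule.span ℂ (b '' {i | k i = c}) := by
  refine le_antisymm (fun x hx => ?_) (Submodule.span_le.2 ?_)
  · have h := b.mem_span_of_inner_eq_zero hc.toFinset (x := x) fun i hi =>
      (HilbertBasis.eq_or_inner_eq_zero_of_diagonal hsymm hk
        (Module.End.mem_eigenspace_iff.1 hx) i).resolve_left fun h => hi <| by
          simpa using (Complex.ofReal_injective h).symm
    rwa [hc.coe_toFinset] at h
  · rintro _ ⟨i, rfl, rfl⟩
    exact Module.End.mem_eigenspace_iff.2 (hk i)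

theorem HilbertBasis.toENat_rank_span (b : HilbertBasis ι ℂ E) (J : Set ι) :
    Cardinal.toENat (Module.rank ℂ (Submodule.span ℂ (b '' J))) = J.encard := by
  have h := rank_span_set (R := ℂ) (s := b '' J)
    (b.orthonormal.linearIndependent.linearIndepOn_id.mono (Set.image_subset_range _ _))
  rw [h, ← b.orthonormal.linearIndependent.injective.encard_image J]
  rfl

theorem HilbertBasis.inner_eq_zero_of_mem_span (b : HilbertBasis ι ℂ E) {J : Set ι} {x : E}
    (h : x ∈ Submodule.span ℂ (b '' J)) {i : ι} (hi : i ∉ J) : ⟪b i, x⟫_ℂ = 0 := by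
  have : Submodule.span ℂ (b '' J) ≤ LinearMap.ker (innerSL ℂ (b i) : E →ₗ[ℂ] ℂ) := by
    rw [Submodule.span_le]
    rintro _ ⟨l, hl, rfl⟩
    exact b.orthonormal.2 fun h => hi (h ▸ hl)
  exact this h

end Diagonal

end Spectral

/-! ### Finite-dimensional subspaces and maxima of the Rayleigh quotient -/

/-- A subspace of dimension more than the number of given linear functionals contains a nonzero
common zero of them. -/
theorem Submodule.exists_ne_zero_forall_apply_eq_zero {M ι : Type*} [AddCommGroup M] [Module ℂ M]
    (F : Submodule ℂ M) (J : Finset ι) (l : ι → M →ₗ[ℂ] ℂ)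
    (h : J.card < Module.finrank ℂ F) : ∃ x ∈ F, x ≠ 0 ∧ ∀ i ∈ J, l i x = 0 := by
  have : FiniteDimensional ℂ F := Module.finite_of_finrank_pos (by omega)
  let L : F →ₗ[ℂ] (J → ℂ) := LinearMap.pi fun i => (l i).comp F.subtype
  have hL : LinearMap.ker L ≠ ⊥ := LinearMap.ker_ne_bot_of_finrank_lt (by simpa using h)
  obtain ⟨x, hx, hx0⟩ := Submodule.exists_mem_ne_zero_of_ne_bot hL
  exact ⟨x, x.2, by simpa using hx0, fun i hi => congrFun hx ⟨i, hi⟩⟩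

namespace KreinVN

variable {H : Type*} [NormedAddCommGroup H] [InnerProductSpace ℂ H]

section Rayleigh

variable {S : H →ₗ.[ℂ] H}

theorem rayleigh_smul {c : ℂ} (hc : c ≠ 0) (f : S.domain) :
    rayleigh S (c • f) = rayleigh S f := by
  have h : (⟪S (c • f), ((c • f : S.domain) : H)⟫_ℂ).re = ‖c‖ ^ 2 * (⟪S f, (f : H)⟫_ℂ).re := by
    rw [LinearPMap.map_smul, Submodule.coe_smul, inner_smul_left, inner_smul_right, ← mul_assoc,
      Complex.conj_mul', ← Complex.ofReal_pow, Complex.re_ofReal_mul]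
  rw [rayleigh, rayleigh, h, LinearPMap.map_smul, norm_smul, mul_pow]
  exact mul_div_mul_left _ _ (pow_ne_zero 2 (norm_ne_zero_iff.2 hc))

/-- The quotient is invariant under scaling, so it suffices to maximize over the compact unit sphere
of `F`. It is continuous there because `S`, though possibly unbounded, is continuous on a
finite-dimensional space. -/
theorem exists_isGreatest_rayleigh
    (hpos : ∀ f : S.domain, f ≠ 0 → 0 < (⟪S f, (f : H)⟫_ℂ).re)
    (F : Submodule ℂ S.domain) (hF : 0 < Module.finrank ℂ F) :
    ∃ m : ℝ, IsGreatest (rayleigh S '' {f | f ∈ F ∧ f ≠ 0}) m := by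
  have : FiniteDimensional ℂ F := Module.finite_of_finrank_pos hF
  have : Nontrivial F := Module.nontrivial_of_finrank_pos hF
  have : ProperSpace F := FiniteDimensional.proper ℂ F
  have hS : Continuous fun f : F => S (f : S.domain) :=
    (S.toFun.comp F.subtype).continuous_of_finiteDimensional
  have hc : Continuous fun f : F => ((f : S.domain) : H) :=
    continuous_subtype_val.comp continuous_subtype_val
  have hne : ∀ f ∈ Metric.sphere (0 : F) 1, (f : S.domain) ≠ 0 := fun f hf h => by
    have : f = 0 := Subtype.ext h
    simp [this] at hf
  have hcont : ContinuousOn (fun f : F => rayleigh S f) (Metric.sphere 0 1) :=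
    (hS.norm.pow 2).continuousOn.div
      (Complex.continuous_re.comp (hS.inner hc)).continuousOn
      fun f hf => (hpos f (hne f hf)).ne'
  have : NormedSpace ℝ F := NormedSpace.restrictScalars ℝ ℂ F
  obtain ⟨x, hx, hmax⟩ := (isCompact_sphere (0 : F) 1).exists_isMaxOn
    (NormedSpace.sphere_nonempty.2 zero_le_one) hcont
  refine ⟨rayleigh S x, ⟨x, ⟨x.2, hne x hx⟩, rfl⟩, ?_⟩
  rintro _ ⟨f, ⟨hf, hf0⟩, rfl⟩
  have hn : ‖(⟨f, hf⟩ : F)‖ ≠ 0 := by simpa using hf0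
  have hn' : ((‖(⟨f, hf⟩ : F)‖ : ℂ))⁻¹ ≠ 0 := inv_ne_zero (Complex.ofReal_ne_zero.2 hn)
  rw [← rayleigh_smul hn' f]
  refine hmax (a := ((‖(⟨f, hf⟩ : F)‖ : ℂ))⁻¹ • (⟨f, hf⟩ : F)) ?_
  rw [mem_sphere_zero_iff_norm, norm_smul, norm_inv, Complex.norm_real, norm_norm,
    inv_mul_cancel₀ hn]

end Rayleigh

/-! ### Closed range and compact inverse -/

section Range

variable {S : H →ₗ.[ℂ] H}

theorem mul_norm_le_norm_apply {μ : ℝ} 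
    (h : ∀ f : S.domain, μ * ‖(f : H)‖ ^ 2 ≤ (⟪S f, (f : H)⟫_ℂ).re) (f : S.domain) :
    μ * ‖(f : H)‖ ≤ ‖S f‖ := by
  rcases eq_or_ne (f : H) 0 with h0 | h0
  · simp [h0]
  · have h1 := (h f).trans (re_inner_le_norm (𝕜 := ℂ) (S f) (f : H))
    rw [sq, ← mul_assoc] at h1
    exact le_of_mul_le_mul_right h1 (norm_pos_iff.2 h0)

/-- The range is the image of the complete graph under the second projection, which is bounded
below. -/
theorem isClosed_range [CompleteSpace H] (hclosed : S.IsClosed)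
    (hpos : ∃ μ : ℝ, 0 < μ ∧ ∀ f : S.domain, μ * ‖(f : H)‖ ≤ ‖S f‖) :
    IsClosed (LinearMap.range S.toFun : Set H) := by
  obtain ⟨μ, h0, h⟩ := hpos
  have : CompleteSpace S.graph := hclosed.completeSpace_coe
  let p : S.graph →ₗ[ℂ] H := (LinearMap.snd ℂ H H).comp S.graph.subtype
  have hp : Continuous p := continuous_snd.comp continuous_subtype_val
  -- The product carries the maximum norm: `μ⁻¹` controls the first component and `1` the second.
  have hanti : AntilipschitzWith ⟨max μ⁻¹ 1, by positivity⟩ p := by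
    refine AddMonoidHomClass.antilipschitz_of_bound p fun x => ?_
    obtain ⟨f, hf1, hf2⟩ := (LinearPMap.mem_graph_iff S).1 x.2
    have hb := h f
    rw [hf1, hf2] at hb
    change max ‖(x : H × H).1‖ ‖(x : H × H).2‖ ≤ max μ⁻¹ 1 * ‖(x : H × H).2‖
    refine max_le ?_ ?_
    · refine le_trans ?_ (mul_le_mul_of_nonneg_right (le_max_left _ _) (norm_nonneg _))
      rwa [inv_mul_eq_div, le_div_iff₀' h0]
    · refine le_trans ?_ (mul_le_mul_of_nonneg_right (le_max_right _ _) (norm_nonneg _))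
      rw [one_mul]
  have hr : (LinearMap.range S.toFun : Set H) = Set.range p := by
    ext y
    constructor
    · rintro ⟨f, rfl⟩
      exact ⟨⟨(f, S f), S.mem_graph f⟩, rfl⟩
    · rintro ⟨x, rfl⟩
      obtain ⟨f, -, hf2⟩ := (LinearPMap.mem_graph_iff S).1 x.2
      exact ⟨f, hf2⟩
  rw [hr]
  exact hanti.isClosed_range (AddMonoidHomClass.uniformContinuous_of_bound p 1 fun x => by
    rw [one_mul]; exact le_max_right _ _)

/-- The inverse factors as an isometry from the range onto `GraphSpace S`, followed by the compact
embedding. -/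
theorem exists_isCompactOperator_range_inverse
    (hpos : ∃ μ : ℝ, 0 < μ ∧ ∀ f : S.domain, μ * ‖(f : H)‖ ≤ ‖S f‖)
    (hcompact : IsCompactOperator (GraphSpace.embedding S)) :
    ∃ Q : LinearMap.range S.toFun →L[ℂ] H, IsCompactOperator Q ∧
      ∀ f : S.domain, Q (S.toFun.rangeRestrict f) = f := by
  obtain ⟨μ, h0, h⟩ := hpos
  have hinj : Function.Injective S.toFun := by
    refine (injective_iff_map_eq_zero _).2 fun f hf => ?_
    have h1 := h f
    rw [show S f = 0 from hf, norm_zero] at h1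
    have h2 : ‖(f : H)‖ = 0 := le_antisymm (by nlinarith) (norm_nonneg _)
    simpa using h2
  let e := LinearEquiv.ofInjective S.toFun hinj
  have he : ∀ f, e.symm (S.toFun.rangeRestrict f) = f := fun f => e.symm_apply_apply f
  have hes : ∀ g : LinearMap.range S.toFun, S (e.symm g) = g := fun g =>
    congrArg Subtype.val (e.apply_symm_apply g)
  let Q : LinearMap.range S.toFun →L[ℂ] H :=
    (S.domain.subtype.comp e.symm.toLinearMap).mkContinuous μ⁻¹ fun g => by
      have h1 := h (e.symm g)
      rw [hes] at h1
      rw [inv_mul_eq_div, le_div_iff₀' h0]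
      exact h1
  refine ⟨Q, ?_, fun f => congrArg Subtype.val (he f)⟩
  let G : LinearMap.range S.toFun →ₗ[ℂ] GraphSpace S := e.symm.toLinearMap
  have hG : Continuous G := AddMonoidHomClass.continuous_of_bound G 1 fun g => by
    rw [one_mul]
    exact (congrArg norm (hes g)).le
  exact hcompact.comp_clm (⟨G, hG⟩ : LinearMap.range S.toFun →L[ℂ] GraphSpace S)

end Range

/-! ### The Krein–von Neumann extension without the adjoint -/

section Krein

variable [CompleteSpace H] {S : H →ₗ.[ℂ] H}

theorem mem_map_ker_adjoint_iff (hd : Dense (S.domain : Set H)) {n : H} :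
    n ∈ (LinearMap.ker S†.toFun).map S†.domain.subtype ↔ n ∈ (LinearMap.range S.toFun)ᗮ := by
  rw [Submodule.mem_orthogonal']
  constructor
  · rintro ⟨y, hy, rfl⟩ _ ⟨f, rfl⟩
    have h := LinearPMap.adjoint_isFormalAdjoint hd y f
    rw [show S† y = 0 from hy, inner_zero_left] at h
    exact h.symm
  · intro h
    have hn : ∀ x : S.domain, ⟪(0 : H), (x : H)⟫_ℂ = ⟪n, S x⟫_ℂ := fun x => by
      rw [inner_zero_left]
      exact (h _ ⟨x, rfl⟩).symm
    exact ⟨⟨n, LinearPMap.mem_adjoint_domain_of_exists n ⟨0, hn⟩⟩,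
      LinearPMap.adjoint_apply_eq hd _ hn, rfl⟩

/-- In the decomposition `u = f + n` with `n ∈ ker S* = Rᗮ`, where `R` is the range of `S`, the
operator sees only `f`. All later facts about the extension rest on this description. -/
theorem kreinExtension_apply_eq_iff (hd : Dense (S.domain : Set H)) (hs : S.IsFormalAdjoint S)
    {u v : H} :
    (∃ hu : u ∈ (kreinExtension S).domain, kreinExtension S ⟨u, hu⟩ = v) ↔
      ∃ f : S.domain, u - f ∈ (LinearMap.range S.toFun)ᗮ ∧ S f = v := by
  have hle := LinearPMap.IsFormalAdjoint.le_adjoint hd hs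
  have key : ∀ (f : S.domain) (n : H) (hn : n ∈ S†.domain) (h0 : S† ⟨n, hn⟩ = 0)
      (hu : (f : H) + n ∈ (kreinExtension S).domain),
      kreinExtension S ⟨f + n, hu⟩ = S f := by
    intro f n hn h0 hu
    have h1 : kreinExtension S ⟨f + n, hu⟩ = S† (⟨f, hle.1 f.2⟩ + ⟨n, hn⟩) :=
      LinearPMap.domRestrict_apply rfl
    rw [h1, LinearPMap.map_add, h0, add_zero]
    exact (hle.2 rfl).symm
  constructor
  · rintro ⟨hu, rfl⟩
    have hu' := hu
    rw [kreinExtension_domain hd hs] at hu'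
    obtain ⟨f, hf, n, hn, rfl⟩ := Submodule.mem_sup.1 hu'
    refine ⟨⟨f, hf⟩, ?_, ?_⟩
    · rw [add_sub_cancel_left]
      exact (mem_map_ker_adjoint_iff hd).1 hn
    · obtain ⟨y, hy, rfl⟩ := hn
      exact (key ⟨f, hf⟩ y y.2 hy hu).symm
  · rintro ⟨f, hf, rfl⟩
    have hn := (mem_map_ker_adjoint_iff hd).2 hf
    have hu : u ∈ (kreinExtension S).domain := by
      rw [kreinExtension_domain hd hs]
      exact Submodule.mem_sup.2 ⟨f, f.2, u - f, hn, by simp⟩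
    refine ⟨hu, ?_⟩
    obtain ⟨y, hy, hyu⟩ := hn
    have hyu : (y : H) = u - f := hyu
    obtain rfl : u = f + y := by rw [hyu]; abel
    exact key f y y.2 hy hu

end Krein

end KreinVN

/-! ### Spectrum of the extension through the compression of the inverse -/

namespace KreinVN

section Compression

variable {H : Type*} [NormedAddCommGroup H] [InnerProductSpace ℂ H]

/-- The compression of `S⁻¹`, given by `Q`, to the range of `S`. -/
noncomputable def compression (S : H →ₗ.[ℂ] H)
    [(LinearMap.range S.toFun).HasOrthogonalProjection]
    (Q : LinearMap.range S.toFun →L[ℂ] H) :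
    LinearMap.range S.toFun →L[ℂ] LinearMap.range S.toFun :=
  (LinearMap.range S.toFun).orthogonalProjectionOnto ∘L Q

variable {S : H →ₗ.[ℂ] H} [(LinearMap.range S.toFun).HasOrthogonalProjection]
  {Q : LinearMap.range S.toFun →L[ℂ] H}

theorem inner_compression (hQ : ∀ f : S.domain, Q (S.toFun.rangeRestrict f) = f)
    (f : S.domain) (g : LinearMap.range S.toFun) :
    ⟪g, compression S Q (S.toFun.rangeRestrict f)⟫_ℂ = ⟪(g : H), (f : H)⟫_ℂ := by
  rw [compression, ContinuousLinearMap.comp_apply, hQ]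
  exact Submodule.inner_orthogonalProjectionOnto_eq_of_mem_left g (f : H)

theorem isSymmetric_compression (hs : S.IsFormalAdjoint S)
    (hQ : ∀ f : S.domain, Q (S.toFun.rangeRestrict f) = f) :
    (compression S Q : LinearMap.range S.toFun →ₗ[ℂ] LinearMap.range S.toFun).IsSymmetric := by
  intro x y
  obtain ⟨f, rfl⟩ := S.toFun.surjective_rangeRestrict x
  obtain ⟨k, rfl⟩ := S.toFun.surjective_rangeRestrict y
  change ⟪compression S Q _, _⟫_ℂ = ⟪_, compression S Q _⟫_ℂ
  rw [inner_compression hQ, ← inner_conj_symm, inner_compression hQ, inner_conj_symm]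
  exact (hs f k).symm

theorem sub_mem_orthogonal_range_iff (hQ : ∀ f : S.domain, Q (S.toFun.rangeRestrict f) = f)
    (f : S.domain) (u : H) :
    u - f ∈ (LinearMap.range S.toFun)ᗮ ↔
      compression S Q (S.toFun.rangeRestrict f) =
        (LinearMap.range S.toFun).orthogonalProjectionOnto u := by
  rw [← Submodule.orthogonalProjectionOnto_eq_zero_iff, map_sub, sub_eq_zero, compression,
    ContinuousLinearMap.comp_apply, hQ, eq_comm]

theorem isEigenvalue_of_eigenspace_ne_bot {A : H →ₗ.[ℂ] H} {z : ℂ} (h : eigenspace A z ≠ ⊥) :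
    IsEigenvalue A z := by
  obtain ⟨x, hx, hx0⟩ := Submodule.exists_mem_ne_zero_of_ne_bot h
  obtain ⟨hx, he⟩ := mem_eigenspace.1 hx
  exact ⟨⟨x, hx⟩, hx0, he⟩

end Compression

variable {H : Type*} [NormedAddCommGroup H] [InnerProductSpace ℂ H] [CompleteSpace H]
  {S : H →ₗ.[ℂ] H} [(LinearMap.range S.toFun).HasOrthogonalProjection]
  {Q : LinearMap.range S.toFun →L[ℂ] H}

/-- For `z ≠ 0` an eigenvector `u = z⁻¹ S f` lies in the range of `S`, and the condition that `u -
f` be orthogonal to the range says that the compression maps `S f` to `u`. -/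
theorem eigenspace_kreinExtension_eq_map (hd : Dense (S.domain : Set H))
    (hs : S.IsFormalAdjoint S) (hQ : ∀ f : S.domain, Q (S.toFun.rangeRestrict f) = f)
    {z : ℂ} (hz : z ≠ 0) :
    eigenspace (kreinExtension S) z =
      (Module.End.eigenspace (compression S Q : Module.End ℂ (LinearMap.range S.toFun)) z⁻¹).map
        (LinearMap.range S.toFun).subtype := by
  ext u
  rw [mem_eigenspace, kreinExtension_apply_eq_iff hd hs]
  constructor
  · rintro ⟨f, hf, hfu⟩
    have hu : u = z⁻¹ • S f := by rw [hfu, inv_smul_smul₀ hz]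
    refine ⟨z⁻¹ • S.toFun.rangeRestrict f, Module.End.mem_eigenspace_iff.2 ?_, hu.symm⟩
    rw [sub_mem_orthogonal_range_iff hQ f] at hf
    rw [map_smul]
    congr 1
    refine hf.trans ?_
    rw [hu]
    exact Submodule.orthogonalProjectionOnto_mem_subspace_eq_self
      (z⁻¹ • S.toFun.rangeRestrict f)
  · rintro ⟨g, hg, rfl⟩
    obtain ⟨k, rfl⟩ := S.toFun.surjective_rangeRestrict g
    have hg' : compression S Q (S.toFun.rangeRestrict k) = z⁻¹ • S.toFun.rangeRestrict k :=
      Module.End.mem_eigenspace_iff.1 hg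
    refine ⟨z • k, ?_, ?_⟩
    · rw [sub_mem_orthogonal_range_iff hQ, map_smul, map_smul, hg', smul_inv_smul₀ hz]
      exact (Submodule.orthogonalProjectionOnto_mem_subspace_eq_self _).symm
    · exact S.map_smul z k

/-- Write `T` for the compression and `P` for the projection. If `S_K u = v` and `v - z u = g`, then
`P u = T v`, so `P g = v - z T v` and `v = A P g` with `A = (1 - z T)⁻¹`. Hence `u = z⁻¹ (A P g -
g)`, which is the inverse used. -/
theorem mem_resolventSet_kreinExtension (hd : Dense (S.domain : Set H))
    (hs : S.IsFormalAdjoint S) (hQ : ∀ f : S.domain, Q (S.toFun.rangeRestrict f) = f)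
    {z : ℂ} (hz : z ≠ 0) (h : z⁻¹ ∈ _root_.resolventSet ℂ (compression S Q)) :
    z ∈ resolventSet (kreinExtension S) := by
  obtain ⟨A, hA1, hA2⟩ : ∃ A : LinearMap.range S.toFun →L[ℂ] LinearMap.range S.toFun,
      (∀ g, A g - z • compression S Q (A g) = g) ∧
      ∀ g, A (g - z • compression S Q g) = g := by
    obtain ⟨B, hB⟩ := spectrum.mem_resolventSet_iff.1 h
    have hB' : ∀ g, (B : LinearMap.range S.toFun →L[ℂ] LinearMap.range S.toFun) g =
        z⁻¹ • g - compression S Q g := fun g => by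
      rw [hB]; simp [Algebra.algebraMap_eq_smul_one]
    have hz' : ∀ g, g - z • compression S Q g =
        z • (B : LinearMap.range S.toFun →L[ℂ] LinearMap.range S.toFun) g := fun g => by
      rw [hB', smul_sub, smul_inv_smul₀ hz]
    refine ⟨z⁻¹ • (B⁻¹ : (LinearMap.range S.toFun →L[ℂ] LinearMap.range S.toFun)ˣ),
      fun g => ?_, fun g => ?_⟩
    · rw [hz', smul_apply, map_smul, smul_inv_smul₀ hz,
        ← mul_apply_eq_comp, B.mul_inv]
      rfl
    · rw [hz', smul_apply, map_smul, inv_smul_smul₀ hz,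
        ← mul_apply_eq_comp, B.inv_mul]
      rfl
  let P := (LinearMap.range S.toFun).orthogonalProjectionOnto
  have hPR : ∀ g : LinearMap.range S.toFun, P (g : H) = g :=
    Submodule.orthogonalProjectionOnto_mem_subspace_eq_self
  refine ⟨z⁻¹ • ((LinearMap.range S.toFun).subtypeL ∘L A ∘L P - ContinuousLinearMap.id ℂ H),
    fun g => ?_, fun u => ?_⟩
  · set u : H := (z⁻¹ • ((LinearMap.range S.toFun).subtypeL ∘L A ∘L P -
      ContinuousLinearMap.id ℂ H)) g with hu_def
    have hu : u = z⁻¹ • ((A (P g) : H) - g) := rfl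
    obtain ⟨f, hf⟩ := S.toFun.surjective_rangeRestrict (A (P g))
    have hSf : S f = A (P g) := congrArg Subtype.val hf
    obtain ⟨hu1, hu2⟩ := (kreinExtension_apply_eq_iff (u := u) (v := S f) hd hs).2
      ⟨f, by
        rw [sub_mem_orthogonal_range_iff hQ f, hf]
        change _ = P u
        rw [hu, map_smul, map_sub, hPR, eq_inv_smul_iff₀ hz, eq_sub_iff_add_eq',
          ← eq_sub_iff_add_eq]
        exact (hA1 (P g)).symm, rfl⟩
    refine ⟨hu1, ?_⟩
    rw [hu2, hSf, hu, smul_inv_smul₀ hz, sub_sub_cancel]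
  · obtain ⟨f, hf, hfu⟩ := (kreinExtension_apply_eq_iff hd hs).1 ⟨u.2, rfl⟩
    rw [← hfu]
    rw [sub_mem_orthogonal_range_iff hQ f] at hf
    change z⁻¹ • ((A (P (S f - z • (u : H))) : H) - (S f - z • (u : H))) = u
    have hP : P (S f - z • (u : H)) =
        S.toFun.rangeRestrict f - z • compression S Q (S.toFun.rangeRestrict f) := by
      rw [map_sub, map_smul, hf]
      congr 1
      exact hPR (S.toFun.rangeRestrict f)
    rw [hP, hA2]
    change z⁻¹ • (S f - (S f - z • (u : H))) = u
    rw [sub_sub_cancel, inv_smul_smul₀ hz]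

/-- The orthogonal complement of the range is the kernel of the extension. If it is trivial, the
closed range is all of `H` and `Q` inverts the extension. -/
theorem isEigenvalue_zero_or_mem_resolventSet (hd : Dense (S.domain : Set H))
    (hs : S.IsFormalAdjoint S) (hQ : ∀ f : S.domain, Q (S.toFun.rangeRestrict f) = f) :
    IsEigenvalue (kreinExtension S) 0 ∨ 0 ∈ resolventSet (kreinExtension S) := by
  by_cases hbot : (LinearMap.range S.toFun)ᗮ = ⊥
  · right
    have htop : ∀ g, g ∈ LinearMap.range S.toFun := fun g => by
      rw [Submodule.orthogonal_eq_bot_iff.1 hbot]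
      trivial
    refine ⟨Q ∘L (LinearMap.range S.toFun).orthogonalProjectionOnto, fun g => ?_, fun u => ?_⟩
    · obtain ⟨f, rfl⟩ := htop g
      have hQf : (Q ∘L (LinearMap.range S.toFun).orthogonalProjectionOnto) (S.toFun f) = f :=
        (congrArg Q (Submodule.orthogonalProjectionOnto_mem_subspace_eq_self
          (S.toFun.rangeRestrict f))).trans (hQ f)
      simp only [hQf, zero_smul, sub_zero]
      exact (kreinExtension_apply_eq_iff hd hs).2 ⟨f, by simp, rfl⟩
    · obtain ⟨f, hf, hfu⟩ := (kreinExtension_apply_eq_iff hd hs).1 ⟨u.2, rfl⟩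
      rw [hbot, Submodule.mem_bot, sub_eq_zero] at hf
      rw [← hfu, zero_smul, sub_zero, hf]
      exact (congrArg Q (Submodule.orthogonalProjectionOnto_mem_subspace_eq_self
          (S.toFun.rangeRestrict f))).trans (hQ f)
  · left
    obtain ⟨n, hn, hn0⟩ := Submodule.exists_mem_ne_zero_of_ne_bot hbot
    obtain ⟨hu, hun⟩ := (kreinExtension_apply_eq_iff (u := n) (v := 0) hd hs).2
      ⟨0, by simpa using hn, S.map_zero⟩
    exact ⟨⟨n, hu⟩, hn0, by rw [hun, zero_smul]⟩

end KreinVN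

theorem Set.Finite.exists_pos_forall_dist_lt {X : Type*} [MetricSpace X] {A : Set X}
    (hA : A.Finite) (z : X) : ∃ ε : ℝ, 0 < ε ∧ ∀ w ∈ A, dist w z < ε → w = z := by
  have hcl : IsClosed (A \ {z}) := (hA.subset Set.sdiff_subset).isClosed
  obtain ⟨ε, hε, h⟩ := Metric.isOpen_iff.1 hcl.isOpen_compl z (by simp)
  refine ⟨ε, hε, fun w hw hd => ?_⟩
  by_contra hne
  exact h hd ⟨hw, hne⟩

/-! ### Min-max principle and the eigenvalue list -/

namespace KreinVN

variable {H : Type u} [NormedAddCommGroup H] [InnerProductSpace ℂ H] {S : H →ₗ.[ℂ] H}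
  [(LinearMap.range S.toFun).HasOrthogonalProjection]
  {Q : LinearMap.range S.toFun →L[ℂ] H}
  {ι : Type u} {b : HilbertBasis ι ℂ (LinearMap.range S.toFun)} {k : ι → ℝ}

theorem rayleigh_eq_div_compression (hQ : ∀ f : S.domain, Q (S.toFun.rangeRestrict f) = f)
    (f : S.domain) :
    rayleigh S f = ‖S.toFun.rangeRestrict f‖ ^ 2 /
      (⟪S.toFun.rangeRestrict f, compression S Q (S.toFun.rangeRestrict f)⟫_ℂ).re := by
  rw [inner_compression hQ]
  rfl

/-- If `S f = b i`, then `k i = (S f, f)`. -/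
theorem pos_of_compression_apply_eq
    (hpos : ∀ f : S.domain, f ≠ 0 → 0 < (⟪S f, (f : H)⟫_ℂ).re)
    (hQ : ∀ f : S.domain, Q (S.toFun.rangeRestrict f) = f)
    (hk : ∀ i, compression S Q (b i) = (k i : ℂ) • b i) (i : ι) : 0 < k i := by
  obtain ⟨f, hf⟩ := S.toFun.surjective_rangeRestrict (b i)
  have hf0 : f ≠ 0 := by
    rintro rfl
    have := b.orthonormal.1 i
    rw [← hf, map_zero, norm_zero] at this
    exact zero_ne_one this
  have h1 := hpos f hf0
  have h2 := inner_compression hQ f (b i)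
  rw [hf, hk, inner_smul_right, inner_self_eq_norm_sq_to_K, b.orthonormal.1, ← hf] at h2
  have h3 : (k i : ℂ) = ⟪S f, (f : H)⟫_ℂ := by simpa using h2
  rw [← h3] at h1
  exact h1

/-- The min-max principle for the Rayleigh quotient, with the eigenvalues indexed by a Hilbert
basis. The set `J` contains the indices of the eigenvalues preceding `(k i₀)⁻¹`. -/
theorem isLeast_isGreatest_rayleigh (hs : S.IsFormalAdjoint S)
    (hpos : ∀ f : S.domain, f ≠ 0 → 0 < (⟪S f, (f : H)⟫_ℂ).re)
    (hQ : ∀ f : S.domain, Q (S.toFun.rangeRestrict f) = f)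
    (hk : ∀ i, compression S Q (b i) = (k i : ℂ) • b i) {J : Finset ι} {i₀ : ι} (hi₀ : i₀ ∉ J)
    (hJ : ∀ i ∈ J, k i₀ ≤ k i) (hJ' : ∀ i ∉ J, k i ≤ k i₀) :
    IsLeast {m : ℝ | ∃ F : Submodule ℂ S.domain, Module.finrank ℂ F = J.card + 1 ∧
      IsGreatest (rayleigh S '' {f | f ∈ F ∧ f ≠ 0}) m} (k i₀)⁻¹ := by
  classical
  have hsymm := isSymmetric_compression hs hQ
  have hkpos : ∀ i, 0 < k i := pos_of_compression_apply_eq hpos hQ hk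
  have hden : ∀ f : S.domain, f ≠ 0 →
      0 < (⟪S.toFun.rangeRestrict f, compression S Q (S.toFun.rangeRestrict f)⟫_ℂ).re := by
    intro f hf
    rw [inner_compression hQ]
    exact hpos f hf
  constructor
  · have hinj : Function.Injective S.toFun.rangeRestrict := by
      refine (injective_iff_map_eq_zero _).2 fun f hf => ?_
      by_contra hf0
      have h1 := hden f hf0
      simp [hf] at h1
    let e : S.domain ≃ₗ[ℂ] LinearMap.range S.toFun :=
      LinearEquiv.ofBijective S.toFun.rangeRestrict ⟨hinj, S.toFun.surjective_rangeRestrict⟩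
    -- The minimizing subspace is the preimage under `S` of the span of the basis vectors up to
    -- `i₀`; on it the quotient is largest at the preimage of `b i₀`.
    let G : Submodule ℂ (LinearMap.range S.toFun) :=
      Submodule.span ℂ (b '' (insert i₀ J : Finset ι))
    have hG : Module.finrank ℂ G = J.card + 1 := by
      have h1 := b.toENat_rank_span (insert i₀ J : Finset ι)
      rw [Set.encard_coe_eq_coe_finsetCard, Finset.card_insert_of_notMem hi₀] at h1
      exact Module.finrank_eq_of_rank_eq (Cardinal.toENat_eq_natCast.1 h1)
    have hF : ∀ f, f ∈ G.map (e.symm : LinearMap.range S.toFun →ₗ[ℂ] S.domain) ↔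
        S.toFun.rangeRestrict f ∈ G := by
      intro f
      constructor
      · rintro ⟨g, hg, rfl⟩
        exact (e.apply_symm_apply g).symm ▸ hg
      · exact fun h => ⟨_, h, e.symm_apply_apply f⟩
    refine ⟨G.map (e.symm : LinearMap.range S.toFun →ₗ[ℂ] S.domain), ?_, ?_, ?_⟩
    · rw [← hG]
      exact LinearEquiv.finrank_map_eq e.symm G
    · have he : S.toFun.rangeRestrict (e.symm (b i₀)) = b i₀ := e.apply_symm_apply _
      refine ⟨e.symm (b i₀), ⟨?_, fun h => ?_⟩, ?_⟩
      · rw [hF, he]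
        exact Submodule.subset_span ⟨i₀, by simp, rfl⟩
      · have := b.orthonormal.1 i₀
        rw [← he, h, map_zero, norm_zero] at this
        exact zero_ne_one this
      · rw [rayleigh_eq_div_compression hQ, he, hk, inner_smul_right, Complex.re_ofReal_mul,
          inner_self_eq_norm_sq_to_K, b.orthonormal.1]
        simp
    · rintro _ ⟨f, ⟨hf, hf0⟩, rfl⟩
      have h1 := HilbertBasis.le_re_inner_of_diagonal (b := b) (c := k i₀) hsymm hk
        (x := S.toFun.rangeRestrict f) fun i => by
          by_cases hi : i ∈ (insert i₀ J : Finset ι)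
          · right
            rcases Finset.mem_insert.1 hi with rfl | hi
            · exact le_rfl
            · exact hJ i hi
          · exact Or.inl (b.inner_eq_zero_of_mem_span ((hF f).1 hf) hi)
      rw [rayleigh_eq_div_compression hQ, div_le_iff₀ (hden f hf0), inv_mul_eq_div,
        le_div_iff₀' (hkpos i₀)]
      exact h1
  · rintro m ⟨F, hF, hm⟩
    -- `F` has one dimension more than `J` has indices, so some nonzero `f ∈ F` has `S f` orthogonal
    -- to every `b i` with `i ∈ J`; its quotient is at least `(k i₀)⁻¹`.
    obtain ⟨f, hf, hf0, hfJ⟩ := F.exists_ne_zero_forall_apply_eq_zero J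
      (fun i => (innerSL ℂ (b i) : LinearMap.range S.toFun →ₗ[ℂ] ℂ) ∘ₗ S.toFun.rangeRestrict)
      (by omega)
    refine le_trans ?_ (hm.2 ⟨f, ⟨hf, hf0⟩, rfl⟩)
    have h1 := HilbertBasis.re_inner_le_of_diagonal (b := b) (c := k i₀) hsymm hk
      (x := S.toFun.rangeRestrict f) fun i => by
        by_cases hi : i ∈ J
        · exact Or.inl (hfJ i hi)
        · exact Or.inr (hJ' i hi)
    rw [rayleigh_eq_div_compression hQ, le_div_iff₀ (hden f hf0), inv_mul_eq_div,
      div_le_iff₀' (hkpos i₀)]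
    exact h1

variable [CompleteSpace H]

theorem eigenspace_kreinExtension_eq_map_span (hd : Dense (S.domain : Set H))
    (hs : S.IsFormalAdjoint S) (hQ : ∀ f : S.domain, Q (S.toFun.rangeRestrict f) = f)
    (hk : ∀ i, compression S Q (b i) = (k i : ℂ) • b i)
    (hfin : ∀ ε, 0 < ε → {i | ε ≤ k i}.Finite) {t : ℝ} (ht : 0 < t) :
    eigenspace (kreinExtension S) (t : ℂ) =
      (Submodule.span ℂ (b '' {i | k i = t⁻¹})).map (LinearMap.range S.toFun).subtype := by
  rw [eigenspace_kreinExtension_eq_map hd hs hQ (Complex.ofReal_ne_zero.2 ht.ne'),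
    ← Complex.ofReal_inv,
    HilbertBasis.eigenspace_eq_span_of_diagonal (isSymmetric_compression hs hQ) hk
      ((hfin _ (inv_pos.2 ht)).subset fun i (hi : k i = t⁻¹) => hi.ge)]

theorem toENat_rank_eigenspace_kreinExtension (hd : Dense (S.domain : Set H))
    (hs : S.IsFormalAdjoint S) (hQ : ∀ f : S.domain, Q (S.toFun.rangeRestrict f) = f)
    (hk : ∀ i, compression S Q (b i) = (k i : ℂ) • b i)
    (hfin : ∀ ε, 0 < ε → {i | ε ≤ k i}.Finite) {t : ℝ} (ht : 0 < t) :
    Cardinal.toENat (Module.rank ℂ (eigenspace (kreinExtension S) (t : ℂ))) =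
      {i | k i = t⁻¹}.encard := by
  rw [eigenspace_kreinExtension_eq_map_span hd hs hQ hk hfin ht, ← b.toENat_rank_span,
    ← LinearEquiv.rank_eq (Submodule.equivMapOfInjective _
      (LinearMap.range S.toFun).injective_subtype _)]

theorem isPosEigenvalueList_kreinExtension (hd : Dense (S.domain : Set H))
    (hs : S.IsFormalAdjoint S) (hQ : ∀ f : S.domain, Q (S.toFun.rangeRestrict f) = f)
    (hk : ∀ i, compression S Q (b i) = (k i : ℂ) • b i) (hkpos : ∀ i, 0 < k i)
    (hfin : ∀ ε, 0 < ε → {i | ε ≤ k i}.Finite) {r : ι → ℕ} (hinj : Function.Injective r)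
    (hr : ∀ j : ℕ, (1 ≤ j ∧ (j : ℕ∞) ≤ ENat.card ι) ↔ ∃ i, r i = j)
    (hmono : ∀ i l, r i ≤ r l → (k i)⁻¹ ≤ (k l)⁻¹) {lam : ℕ → ℝ}
    (hlam : ∀ i, lam (r i) = (k i)⁻¹) :
    IsPosEigenvalueList (kreinExtension S) (ENat.card ι) lam where
  pos j h1 h2 := by
    obtain ⟨i, rfl⟩ := (hr j).1 ⟨h1, h2⟩
    rw [hlam]
    exact inv_pos.2 (hkpos i)
  mono i j h1 hij h2 := by
    obtain ⟨l, rfl⟩ := (hr j).1 ⟨h1.trans hij, h2⟩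
    obtain ⟨m, rfl⟩ := (hr i).1 ⟨h1, le_trans (by exact_mod_cast hij) h2⟩
    rw [hlam, hlam]
    exact hmono m l hij
  mult t ht := by
    rw [toENat_rank_eigenspace_kreinExtension hd hs hQ hk hfin ht, ← hinj.encard_image]
    congr 1
    ext j
    constructor
    · rintro ⟨h1, h2, h3⟩
      obtain ⟨i, rfl⟩ := (hr j).1 ⟨h1, h2⟩
      rw [hlam] at h3
      exact ⟨i, by rw [← h3]; simp, rfl⟩
    · rintro ⟨i, hi, rfl⟩
      obtain ⟨h1, h2⟩ := (hr (r i)).2 ⟨i, rfl⟩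
      refine ⟨h1, h2, ?_⟩
      rw [hlam, show k i = t⁻¹ from hi, inv_inv]

theorem isEigenvalue_and_eq_of_mem_spectrum_kreinExtension [CompleteSpace (LinearMap.range S.toFun)]
    (hd : Dense (S.domain : Set H))
    (hs : S.IsFormalAdjoint S) (hQ : ∀ f : S.domain, Q (S.toFun.rangeRestrict f) = f)
    (hcomp : IsCompactOperator Q)
    (hk : ∀ i, compression S Q (b i) = (k i : ℂ) • b i) {z : ℂ}
    (hz : z ∈ spectrum (kreinExtension S)) :
    IsEigenvalue (kreinExtension S) z ∧ (z = 0 ∨ ∃ i, z = ((k i)⁻¹ : ℝ)) := by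
  rcases eq_or_ne z 0 with rfl | hz0
  · exact ⟨(isEigenvalue_zero_or_mem_resolventSet hd hs hQ).resolve_right hz, Or.inl rfl⟩
  · have hT : IsCompactOperator (compression S Q) :=
      hcomp.clm_comp (LinearMap.range S.toFun).orthogonalProjectionOnto
    have hev := (hT.hasEigenvalue_or_mem_resolventSet (inv_ne_zero hz0)).resolve_right
      fun h => hz (mem_resolventSet_kreinExtension hd hs hQ hz0 h)
    refine ⟨isEigenvalue_of_eigenspace_ne_bot fun hbot => ?_, Or.inr ?_⟩
    · rw [eigenspace_kreinExtension_eq_map hd hs hQ hz0] at hbot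
      exact hev (Submodule.map_injective_of_injective (LinearMap.range S.toFun).injective_subtype
        (hbot.trans (Submodule.map_bot _).symm))
    · obtain ⟨x, hx⟩ := hev.exists_hasEigenvector
      by_contra hcon
      refine hx.2 (b.eq_zero_of_inner_eq_zero fun i =>
        (HilbertBasis.eq_or_inner_eq_zero_of_diagonal (isSymmetric_compression hs hQ) hk
          hx.apply_eq_smul i).resolve_left fun h => hcon ⟨i, ?_⟩)
      rw [Complex.ofReal_inv, ← h, inv_inv]

end KreinVN

/-! ### The main theorem -/

theorem theorem2p4 {H : Type*} [NormedAddCommGroup H] [InnerProductSpace ℂ H] [CompleteSpace H]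
    (S : H →ₗ.[ℂ] H)
    (hclosed : S.IsClosed)
    (hdense : Dense (S.domain : Set H))
    (hsymm : S.IsFormalAdjoint S)
    (hpos : ∃ μ : ℝ, 0 < μ ∧ ∀ f : S.domain, μ * ‖(f : H)‖ ^ 2 ≤ (⟪S f, (f : H)⟫_ℂ).re)
    (hcompact : IsCompactOperator (KreinVN.GraphSpace.embedding S)) :
    -- the spectrum is nonnegative
    (∀ z ∈ KreinVN.spectrum (KreinVN.kreinExtension S), z.im = 0 ∧ 0 ≤ z.re) ∧
    -- it consists of isolated eigenvalues
    (∀ z ∈ KreinVN.spectrum (KreinVN.kreinExtension S),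
      KreinVN.IsEigenvalue (KreinVN.kreinExtension S) z ∧
      ∃ ε : ℝ, 0 < ε ∧
        ∀ w ∈ KreinVN.spectrum (KreinVN.kreinExtension S), dist w z < ε → w = z) ∧
    -- the positive eigenvalues have finite multiplicities
    (∀ t : ℝ, 0 < t →
      FiniteDimensional ℂ (KreinVN.eigenspace (KreinVN.kreinExtension S) (t : ℂ))) ∧
    -- the positive eigenvalues can be listed in nondecreasing order, and there are `dim (dom S)`
    -- of them, counted with multiplicities
    (∃ lam : ℕ → ℝ, KreinVN.IsPosEigenvalueList (KreinVN.kreinExtension S)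
      (Cardinal.toENat (Module.rank ℂ S.domain)) lam) ∧
    -- the min-max principle; the maxima and the minimum are attained
    (∀ (N : ℕ∞) (lam : ℕ → ℝ),
      KreinVN.IsPosEigenvalueList (KreinVN.kreinExtension S) N lam →
      ∀ j : ℕ, 1 ≤ j → (j : ℕ∞) ≤ N →
        (∀ F : Submodule ℂ S.domain, Module.finrank ℂ F = j →
          ∃ m : ℝ, IsGreatest (KreinVN.rayleigh S '' {f | f ∈ F ∧ f ≠ 0}) m) ∧
        IsLeast {m : ℝ | ∃ F : Submodule ℂ S.domain, Module.finrank ℂ F = j ∧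
          IsGreatest (KreinVN.rayleigh S '' {f | f ∈ F ∧ f ≠ 0}) m} (lam j)) := by
  have hform : ∀ f : S.domain, f ≠ 0 → 0 < (⟪S f, (f : H)⟫_ℂ).re := by
    obtain ⟨μ, h0, h⟩ := hpos
    intro f hf
    have hn : 0 < ‖(f : H)‖ := norm_pos_iff.2 fun h => hf (Subtype.ext h)
    exact (by positivity : 0 < μ * ‖(f : H)‖ ^ 2).trans_le (h f)
  have hbound : ∃ μ : ℝ, 0 < μ ∧ ∀ f : S.domain, μ * ‖(f : H)‖ ≤ ‖S f‖ :=
    let ⟨μ, h0, h⟩ := hpos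
    ⟨μ, h0, KreinVN.mul_norm_le_norm_apply h⟩
  have : CompleteSpace (LinearMap.range S.toFun) :=
    (KreinVN.isClosed_range hclosed hbound).completeSpace_coe
  obtain ⟨Q, hQcomp, hQ⟩ := KreinVN.exists_isCompactOperator_range_inverse hbound hcompact
  have hsym := KreinVN.isSymmetric_compression hsymm hQ
  have hcomp : IsCompactOperator (KreinVN.compression S Q) :=
    hQcomp.clm_comp (LinearMap.range S.toFun).orthogonalProjectionOnto
  obtain ⟨ι, b, k, hk⟩ := HilbertBasis.exists_real_eigenvalues _ hcomp hsym
  have hkpos := KreinVN.pos_of_compression_apply_eq hform hQ hk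
  have hfin : ∀ ε, 0 < ε → {i | ε ≤ k i}.Finite := fun ε hε =>
    hcomp.finite_setOf_le_eigenvalue b.orthonormal hk hε
  have hfin' : ∀ t, {i | (k i)⁻¹ ≤ t}.Finite := fun t =>
    -- The bound `t` need not be positive; `max t 1` is.
    (hfin (max t 1)⁻¹ (by positivity)).subset fun i (hi : (k i)⁻¹ ≤ t) =>
      inv_le_of_inv_le₀ (hkpos i) (hi.trans (le_max_left t 1))
  obtain ⟨r, hinj, hr, hmono⟩ := exists_monotone_numbering (fun i => (k i)⁻¹) hfin'
  -- The default value `0` is taken only outside the index range of the list.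
  let lam : ℕ → ℝ := Function.extend r (fun i => (k i)⁻¹) 0
  have hlam : ∀ i, lam (r i) = (k i)⁻¹ := fun i => hinj.extend_apply _ _ i
  have hlist := KreinVN.isPosEigenvalueList_kreinExtension hdense hsymm hQ hk hkpos hfin hinj hr
    hmono hlam
  have hspec := fun z hz =>
    KreinVN.isEigenvalue_and_eq_of_mem_spectrum_kreinExtension (z := z) hdense hsymm hQ hQcomp hk hz
  have hinjS : Function.Injective S.toFun := by
    refine (injective_iff_map_eq_zero _).2 fun f hf => ?_
    by_contra hf0
    have h1 := hform f hf0
    rw [show S f = 0 from hf, inner_zero_left] at h1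
    exact lt_irrefl _ h1
  have hcard : Cardinal.toENat (Module.rank ℂ S.domain) = ENat.card ι := by
    rw [← b.toENat_rank, (LinearEquiv.ofInjective S.toFun hinjS).rank_eq]
  refine ⟨fun z hz => ?_, fun z hz => ⟨(hspec z hz).1, ?_⟩, fun t ht => ?_,
    ⟨lam, hcard ▸ hlist⟩, fun N lam' hlist' j hj hjN => ⟨fun F hF => ?_, ?_⟩⟩
  · rcases (hspec z hz).2 with rfl | ⟨i, rfl⟩
    · simp
    · exact ⟨Complex.ofReal_im _, by rw [Complex.ofReal_re]; exact (inv_pos.2 (hkpos i)).le⟩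
  · have hA : (insert (0 : ℂ)
        ((fun i => (((k i)⁻¹ : ℝ) : ℂ)) '' {i | (k i)⁻¹ ≤ z.re + 1})).Finite :=
      ((hfin' _).image _).insert 0
    obtain ⟨ε, hε, h⟩ := hA.exists_pos_forall_dist_lt z
    refine ⟨min ε 1, lt_min hε one_pos, fun w hw hwz => h w ?_ (hwz.trans_le (min_le_left _ _))⟩
    rcases (hspec w hw).2 with rfl | ⟨i, rfl⟩
    · exact Set.mem_insert _ _
    · refine Set.mem_insert_of_mem _ ⟨i, ?_, rfl⟩
      have h1 := hwz.trans_le (min_le_right _ _)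
      rw [dist_eq_norm] at h1
      have h2 := (le_abs_self _).trans (Complex.abs_re_le_norm ((((k i)⁻¹ : ℝ) : ℂ) - z))
      rw [Complex.sub_re, Complex.ofReal_re] at h2
      change (k i)⁻¹ ≤ z.re + 1
      linarith
  · rw [KreinVN.eigenspace_kreinExtension_eq_map_span hdense hsymm hQ hk hfin ht]
    have hJ : {i | k i = t⁻¹}.Finite :=
      (hfin _ (inv_pos.2 ht)).subset fun i (hi : k i = t⁻¹) => hi.ge
    have := FiniteDimensional.span_of_finite ℂ (hJ.image b)
    infer_instance
  · exact KreinVN.exists_isGreatest_rayleigh hform F (by omega)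
  · obtain ⟨hjN', hj'⟩ := hlist'.eq_of_le hlist j hj hjN
    obtain ⟨i₀, rfl⟩ := (hr j).1 ⟨hj, hjN'⟩
    have hJfin : {i | r i < r i₀}.Finite :=
      (hfin' (k i₀)⁻¹).subset fun i (hi : r i < r i₀) => hmono i i₀ hi.le
    -- The indices before `i₀` bear exactly the numbers `1, …, r i₀ - 1`.
    have hJcard : hJfin.toFinset.card + 1 = r i₀ := by
      have h1 : r '' {i | r i < r i₀} = (Finset.Ico 1 (r i₀) : Finset ℕ) := by
        ext m
        simp only [Set.mem_image, Set.mem_ofPred_eq, Finset.coe_Ico, Set.mem_Ico]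
        constructor
        · rintro ⟨i, hi, rfl⟩
          exact ⟨((hr (r i)).2 ⟨i, rfl⟩).1, hi⟩
        · rintro ⟨hm1, hm2⟩
          obtain ⟨i, rfl⟩ := (hr m).1 ⟨hm1, le_trans (by exact_mod_cast hm2.le) hjN'⟩
          exact ⟨i, hm2, rfl⟩
      have h2 := congrArg Set.ncard h1
      rw [Set.ncard_image_of_injective _ hinj, Set.ncard_coe_finset, Nat.card_Ico,
        Set.ncard_eq_toFinset_card _ hJfin] at h2
      omega
    rw [hj', hlam, ← hJcard]
    refine KreinVN.isLeast_isGreatest_rayleigh hsymm hform hQ hk (J := hJfin.toFinset)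
      (by simp) (fun i hi => ?_) fun i hi => ?_
    · have hi' : r i < r i₀ := by simpa using hi
      exact (inv_le_inv₀ (hkpos i) (hkpos i₀)).1 (hmono i i₀ hi'.le)
    · have hi' : r i₀ ≤ r i := by simpa using hi
      exact (inv_le_inv₀ (hkpos i₀) (hkpos i)).1 (hmono i₀ i hi')
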